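/- Let $\mathbb O$ be the real algebra of octonions, $\mathbb S=\{J\in\mathbb O: J^2=-1\}$, and $\mathbb O_{\mathbb C}=\mathbb O\otimes_{\mathbb R}\mathbb C=\{x+iy: x,y\in\mathbb O\}$ its complexification, with complex conjugation $\overline{x+iy}=x-iy$. For an open set $U\subset\mathbb C^n$ put $$\Omega_U=\{\alpha+J\beta : J\in\mathbb S,\ \alpha,\beta\in\mathbb R^n,\ \alpha+i\beta\in U\}\subset\mathbb O^n .$$ A stem function on $U$ is a map $F=F_1+iF_2:U\to\mathbb O_{\mathbb C}$ (with $F_1,F_2$ valued in $\mathbb O$) such that $F(\bar z)=\overline{F(z)}$ whenever $z\in U$ and $\bar z\in U$ ($U$ need not be invariant under conjugation). It is holomorphic if it is of class $C^1$ and $\frac{\partial F}{\partial\bar z_t}=\frac12\left(\frac{\partial F}{\partial\alpha_t}+i\frac{\partial F}{\partial\beta_t}\right)=0$ on $U$ for $t=1,\dots,n$, where $z=\alpha+i\beta$. A function $f:\Omega_U\to\mathbb O$ is (left) slice regular, written $f\in\mathcal{SR}(\Omega_U,\mathbb O)$, if there is a holomorphic stem function $F=F_1+iF_2$ on $U$ such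 that $f(\alpha+J\beta)=F_1(z)+JF_2(z)$ for all $J\in\mathbb S$ and all $z=\alpha+i\beta\in U$. Theorem (Hartogs). Let $n\ge 2$, let $D\subset\mathbb C^n$ be a domain (a nonempty connected open set), and let $K\subset D$ be a compact set such that $D\setminus K$ is connected. If $f\in\mathcal{SR}(\Omega_{D\setminus K},\mathbb O)$, then there is a function $g\in\mathcal{SR}(\Omega_D,\mathbb O)$ such that $g|_{\Omega_{D\setminus K}}=f$. -/

import Mathlib

open scoped Quaternion

noncomputable section

/-- The octonions, as the Cayley-Dickson double of the quaternions, with the Euclidean norm. -/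
def Octonion : Type := WithLp 2 (ℍ[ℝ] × ℍ[ℝ])

namespace Octonion

instance : NormedAddCommGroup Octonion :=
  inferInstanceAs (NormedAddCommGroup (WithLp 2 (ℍ[ℝ] × ℍ[ℝ])))

instance : NormedSpace ℝ Octonion :=
  inferInstanceAs (NormedSpace ℝ (WithLp 2 (ℍ[ℝ] × ℍ[ℝ])))

/-- The octonion `a + b ℓ`. -/
def mk (a b : ℍ[ℝ]) : Octonion := WithLp.toLp 2 (a, b)

/-- The first quaternionic coordinate. -/
def fst (x : Octonion) : ℍ[ℝ] := (WithLp.ofLp (show WithLp 2 (ℍ[ℝ] × ℍ[ℝ]) from x)).1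

/-- The second quaternionic coordinate. -/
def snd (x : Octonion) : ℍ[ℝ] := (WithLp.ofLp (show WithLp 2 (ℍ[ℝ] × ℍ[ℝ]) from x)).2

instance : One Octonion := ⟨mk 1 0⟩

/-- The Cayley-Dickson product. -/
instance : Mul Octonion :=
  ⟨fun x y => mk (x.fst * y.fst - star y.snd * x.snd) (y.snd * x.fst + x.snd * star y.fst)⟩

/-- The sphere `𝕊` of square roots of `-1`. -/
def imaginaryUnits : Set Octonion := {J | J * J = -1}

end Octonion

/-- The complexified octonions `𝕆 + i 𝕆`. -/
def ComplexOctonion : Type := WithLp 2 (Octonion × Octonion)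

namespace ComplexOctonion

instance : NormedAddCommGroup ComplexOctonion :=
  inferInstanceAs (NormedAddCommGroup (WithLp 2 (Octonion × Octonion)))

instance : NormedSpace ℝ ComplexOctonion :=
  inferInstanceAs (NormedSpace ℝ (WithLp 2 (Octonion × Octonion)))

/-- The element `x + i y`. -/
def mk (x y : Octonion) : ComplexOctonion := WithLp.toLp 2 (x, y)

/-- The component `x` of `x + i y`. -/
def re (w : ComplexOctonion) : Octonion :=
  (WithLp.ofLp (show WithLp 2 (Octonion × Octonion) from w)).1

/-- The component `y` of `x + i y`. -/
def im (w : ComplexOctonion) : Octonion :=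
  (WithLp.ofLp (show WithLp 2 (Octonion × Octonion) from w)).2

/-- `(x + i y) (u + i v) = x u - y v + i (x v + y u)`. -/
instance : Mul ComplexOctonion :=
  ⟨fun w s => mk (w.re * s.re - w.im * s.im) (w.re * s.im + w.im * s.re)⟩

/-- The central imaginary unit `i`. -/
def I : ComplexOctonion := mk 0 1

/-- The complex conjugation `x + i y ↦ x - i y`. -/
def conj (w : ComplexOctonion) : ComplexOctonion := mk w.re (-w.im)

end ComplexOctonion

/-- The map `φ_J : ℂⁿ → ℂ_Jⁿ`, `α + i β ↦ α + J β`. -/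
def slicePoint {n : ℕ} (J : Octonion) (z : Fin n → ℂ) : Fin n → Octonion :=
  fun t => (z t).re • (1 : Octonion) + (z t).im • J

/-- The circular set `Ω_D` generated by `D`. -/
def circularSet {n : ℕ} (D : Set (Fin n → ℂ)) : Set (Fin n → Octonion) :=
  {x | ∃ J ∈ Octonion.imaginaryUnits, ∃ z ∈ D, x = slicePoint J z}

/-- `F` is an octonionic stem function on `D`. The set `D` need not be invariant under
conjugation; the symmetry is required wherever both sides are defined. -/
def IsStemOn {n : ℕ} (D : Set (Fin n → ℂ)) (F : (Fin n → ℂ) → ComplexOctonion) : Prop :=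
  ∀ z ∈ D, star z ∈ D → F (star z) = (F z).conj

/-- The operator `∂F/∂z̄_t = (1/2) (∂F/∂α_t + i ∂F/∂β_t)`. -/
def dbar {n : ℕ} (t : Fin n) (F : (Fin n → ℂ) → ComplexOctonion) (z : Fin n → ℂ) :
    ComplexOctonion :=
  (1 / 2 : ℝ) • (fderiv ℝ F z (Pi.single t 1) +
    ComplexOctonion.I * fderiv ℝ F z (Pi.single t Complex.I))

/-- `F` is holomorphic on the open set `D`: it is `C¹` and `∂F/∂z̄_t = 0` on `D` for all `t`. -/
def IsHolomorphicOn {n : ℕ} (D : Set (Fin n → ℂ)) (F : (Fin n → ℂ) → ComplexOctonion) : Prop :=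
  ContDiffOn ℝ 1 F D ∧ ∀ z ∈ D, ∀ t, dbar t F z = 0

/-- `f = 𝓘(F)` on `Ω_D`, that is, `f (α + J β) = F₁ z + J F₂ z` for all `z = α + i β` in `D`. -/
def IsInducedOn {n : ℕ} (D : Set (Fin n → ℂ)) (F : (Fin n → ℂ) → ComplexOctonion)
    (f : (Fin n → Octonion) → Octonion) : Prop :=
  ∀ J ∈ Octonion.imaginaryUnits, ∀ z ∈ D, f (slicePoint J z) = (F z).re + J * (F z).im

/-- The restriction of `f` to `Ω_D` is (left) slice regular, for `D` open. -/
def IsSliceRegularOn {n : ℕ} (D : Set (Fin n → ℂ)) (f : (Fin n → Octonion) → Octonion) : Prop :=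
  ∃ F : (Fin n → ℂ) → ComplexOctonion, IsStemOn D F ∧ IsHolomorphicOn D F ∧ IsInducedOn D F f

end

/-! A slice regular function is governed by its stem function, so it suffices to extend the stem
function `F` from `D \ K` to `D` holomorphically and to check that the extension is again a stem
function. In complex coordinates (`coords`) this concerns maps from `ℂⁿ` to `ℂᵐ`.

The extension (`hartogs_extension`) follows Ehrenpreis. With a cutoff `χ` equal to `1` near `K` and
supported in a compact `L ⊆ D`, put `G = u + (1 - χ) F`, where `∂̄u = F ∂̄χ`. The Cauchy transform
along one coordinate line gives `u`; since `n ≥ 2`, it vanishes far away, hence on every connected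
set that avoids `L` and reaches infinity. A ray leaving `D` from a point of larger norm than all of
`L` is such a set, so `G = F` near a point of `D \ K`, and the identity theorem does the rest.

The symmetry `G (star z) = star (G z)` is not automatic: the intersection of `D` with its conjugate
`D'` may be disconnected, and the hypothesis on `F` says nothing on a component `W` contained in `K
∪ K'`. No such `W` exists (`not_connectedComponentIn_subset_union`). Otherwise let `p` be a farthest
point of its closure; it lies in exactly one of the two domains, say `D`. The indicator of `W` is
holomorphic on `D'` off a compact subset. If `D'` reached beyond the ball of radius `‖p‖`, the
Hartogs extension of this indicator would vanish on `D'`, being `0` at far points, yet equal `1` at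
points of `W` near `p`. So `D'` lies in that ball, and then so does `D`, because conjugation
preserves the norm; but `p` is an interior point of `D`. -/

open Set Filter Topology MeasureTheory Metric

/-! ### The Cauchy-Riemann operator and the identity theorem -/

section Dbar

variable {V E : Type*} [NormedAddCommGroup V] [NormedSpace ℂ V] [NormedAddCommGroup E]
  [NormedSpace ℂ E]

/-- The Cauchy-Riemann operator along the vector `v`. -/
noncomputable def dbarAlong (v : V) (F : V → E) (z : V) : E :=
  (1 / 2 : ℂ) • (fderiv ℝ F z v + Complex.I • fderiv ℝ F z (Complex.I • v))

theorem fderiv_I_smul_of_dbarAlong_eq_zero {F : V → E} {z v : V} (h : dbarAlong v F z = 0) :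
    fderiv ℝ F z (Complex.I • v) = Complex.I • fderiv ℝ F z v := by
  rw [dbarAlong, smul_eq_zero] at h
  have h' := h.resolve_left (by norm_num)
  rw [eq_neg_of_add_eq_zero_left h', smul_neg, smul_smul, Complex.I_mul_I]
  simp

theorem differentiableAt_complex_of_fderiv_I_smul {F : V → E} {z : V}
    (hd : DifferentiableAt ℝ F z)
    (h : ∀ v, fderiv ℝ F z (Complex.I • v) = Complex.I • fderiv ℝ F z v) :
    DifferentiableAt ℂ F z := by
  refine (differentiableAt_iff_restrictScalars ℝ hd).2 ?_
  refine ⟨⟨{ toFun := fderiv ℝ F z, map_add' := fun x y => map_add _ x y, map_smul' := ?_ },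
    (fderiv ℝ F z).continuous⟩, by ext; rfl⟩
  intro c v
  simp only [RingHom.id_apply]
  conv_lhs => rw [← Complex.re_add_im c, add_smul, mul_smul, map_add]
  conv_rhs => rw [← Complex.re_add_im c, add_smul, mul_smul]
  simp only [Complex.coe_smul, map_smul, h]

theorem dbarAlong_eq_zero_of_differentiableAt {F : V → E} {z : V} (h : DifferentiableAt ℂ F z)
    (v : V) : dbarAlong v F z = 0 := by
  have : fderiv ℝ F z = (fderiv ℂ F z).restrictScalars ℝ :=
    (h.hasFDerivAt.restrictScalars ℝ).fderiv
  rw [dbarAlong, this]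
  simp [smul_smul]

/-- `F` is of class `C¹` over `ℝ` and complex differentiable at `z`. -/
def HolAt (F : V → E) (z : V) : Prop := ContDiffAt ℝ 1 F z ∧ DifferentiableAt ℂ F z

theorem HolAt.of_dbarAlong {F : V → E} {z : V} (h : ContDiffAt ℝ 1 F z)
    (h' : ∀ v, dbarAlong v F z = 0) : HolAt F z :=
  ⟨h, differentiableAt_complex_of_fderiv_I_smul (h.differentiableAt (by simp))
    fun v => fderiv_I_smul_of_dbarAlong_eq_zero (h' v)⟩

theorem HolAt.congr {F G : V → E} {z : V} (h : HolAt F z) (hG : G =ᶠ[𝓝 z] F) : HolAt G z :=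
  ⟨h.1.congr_of_eventuallyEq hG, h.2.congr_of_eventuallyEq hG⟩

theorem HolAt.const (c : E) (z : V) : HolAt (fun _ : V => c) z :=
  ⟨contDiffAt_const, differentiableAt_const c⟩

theorem HolAt.sub {F G : V → E} {z : V} (h : HolAt F z) (h' : HolAt G z) :
    HolAt (fun x => F x - G x) z :=
  ⟨h.1.sub h'.1, h.2.sub h'.2⟩

theorem dbarAlong_add {F G : V → E} {z : V} (hF : DifferentiableAt ℝ F z)
    (hG : DifferentiableAt ℝ G z) (v : V) :
    dbarAlong v (fun x => F x + G x) z = dbarAlong v F z + dbarAlong v G z := by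
  simp only [dbarAlong, fderiv_fun_add hF hG, add_apply, smul_add]
  abel

theorem dbarAlong_smul {χ : V → ℂ} {F : V → E} {z : V} (hχ : DifferentiableAt ℝ χ z)
    (hF : DifferentiableAt ℝ F z) (v : V) :
    dbarAlong v (fun x => χ x • F x) z = χ z • dbarAlong v F z + dbarAlong v χ z • F z := by
  simp only [dbarAlong, fderiv_fun_smul hχ hF]
  simp only [add_apply, smul_apply,
    ContinuousLinearMap.smulRight_apply, smul_eq_mul]
  module

theorem dbarAlong_congr {F G : V → E} {z : V} (h : F =ᶠ[𝓝 z] G) (v : V) :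
    dbarAlong v F z = dbarAlong v G z := by
  simp only [dbarAlong, h.fderiv_eq]

theorem ContDiff.dbarAlong {F : V → E} (h : ContDiff ℝ 2 F) (v : V) :
    ContDiff ℝ 1 (dbarAlong v F) := by
  have h1 : ContDiff ℝ 1 (fderiv ℝ F) := h.fderiv_right (by norm_num)
  unfold _root_.dbarAlong
  fun_prop

/-- Symmetry of the second real derivative. Applied to the cutoff, it yields the compatibility
condition needed to solve `∂̄u = φ`. -/
theorem dbarAlong_comm {F : V → E} (h : ContDiff ℝ 2 F) (v w z : V) :
    dbarAlong v (dbarAlong w F) z = dbarAlong w (dbarAlong v F) z := by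
  have h1 : Differentiable ℝ (fderiv ℝ F) :=
    (h.fderiv_right (m := 1) (by norm_num)).differentiable (by norm_num)
  have hs : ∀ a b, fderiv ℝ (fderiv ℝ F) z a b = fderiv ℝ (fderiv ℝ F) z b a := fun a b =>
    h.contDiffAt.isSymmSndFDerivAt (by simp) a b
  have key : ∀ a b : V, fderiv ℝ (dbarAlong a F) z b = (1 / 2 : ℂ) •
      (fderiv ℝ (fderiv ℝ F) z b a + Complex.I • fderiv ℝ (fderiv ℝ F) z b (Complex.I • a)) := by
    intro a b
    have e : ∀ a b, fderiv ℝ (fun y => fderiv ℝ F y a) z b = fderiv ℝ (fderiv ℝ F) z b a := by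
      intro a b
      rw [fderiv_clm_apply (h1 z) (differentiableAt_const a)]
      simp
    have d : ∀ a, DifferentiableAt ℝ (fun y => fderiv ℝ F y a) z := fun a =>
      (h1 z).clm_apply (differentiableAt_const a)
    unfold dbarAlong
    rw [fderiv_fun_const_smul
        (DifferentiableAt.fun_add (d _) (DifferentiableAt.fun_const_smul (d _) _)),
      fderiv_fun_add (d _) (DifferentiableAt.fun_const_smul (d _) _),
      fderiv_fun_const_smul (d _)]
    simp only [add_apply, smul_apply, e]
  simp only [dbarAlong.eq_1 _ (dbarAlong _ F), key]
  rw [hs v w, hs v (Complex.I • w), hs (Complex.I • v) w, hs (Complex.I • v) (Complex.I • w)]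
  module

/-- The identity theorem on a preconnected subset of an open set. -/
theorem eventuallyEq_zero_of_isPreconnected [CompleteSpace E] {f : V → E} {Ω S : Set V}
    (hΩ : IsOpen Ω) (hf : ∀ z ∈ Ω, DifferentiableAt ℂ f z) (hS : IsPreconnected S) (hSΩ : S ⊆ Ω)
    {x : V} (hx : x ∈ S) (hfx : f =ᶠ[𝓝 x] 0) {y : V} (hy : y ∈ S) : f =ᶠ[𝓝 y] 0 := by
  have hu : IsOpen {z | f =ᶠ[𝓝 z] 0} := isOpen_setOfPred_eventually_nhds
  -- The locus of local vanishing is open; it remains to see that it is relatively closed in `S`.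
  -- Only `Ω` is open, so `S` may be thin, such as a ray or a complex line.
  refine hS.subset_of_closure_inter_subset hu ⟨x, hx, hfx⟩ ?_ hy
  rintro y ⟨hy, hyS⟩
  obtain ⟨r, hr, hball⟩ := Metric.isOpen_iff.1 hΩ y (hSΩ hyS)
  obtain ⟨w, hw, hfw⟩ := mem_closure_iff.1 hy (ball y r) isOpen_ball (mem_ball_self hr)
  refine Filter.mem_of_superset (ball_mem_nhds y hr) fun p hp => ?_
  -- The complex line from `w`, near which `f` vanishes, to an arbitrary `p` in the ball reduces the
  -- claim to the one-variable identity theorem.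
  let l : ℂ → V := fun t => w + t • (p - w)
  have hl : Differentiable ℂ l := by fun_prop
  have hTo : IsOpen (l ⁻¹' ball y r) := isOpen_ball.preimage hl.continuous
  have hTc : IsPreconnected (l ⁻¹' ball y r) := by
    suffices h : Convex ℝ (l ⁻¹' ball y r) from h.isPreconnected
    intro a ha b hb s t hs ht hst
    have : l (s • a + t • b) = s • l a + t • l b := by
      simp only [l, add_smul, smul_add, smul_assoc]
      have : w = s • w + t • w := by rw [← add_smul, hst, one_smul]
      nth_rewrite 1 [this]
      abel
    simp only [mem_preimage, this]
    exact convex_ball y r ha hb hs ht hst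
  have hA : AnalyticOnNhd ℂ (f ∘ l) (l ⁻¹' ball y r) :=
    DifferentiableOn.analyticOnNhd (fun t ht =>
      ((hf _ (hball ht)).comp t (hl t)).differentiableWithinAt) hTo
  have h0 : f ∘ l =ᶠ[𝓝 0] 0 := by
    have : Tendsto l (𝓝 0) (𝓝 w) := by
      have := hl.continuous.tendsto 0
      simpa [l] using this
    exact this.eventually hfw
  have := hA.eqOn_of_preconnected_of_eventuallyEq (fun _ _ => analyticAt_const) hTc
    (z₀ := 0) (by simpa [l] using hw) h0 (show (1 : ℂ) ∈ l ⁻¹' ball y r by simpa [l] using hp)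
  simp only [Function.comp_apply, l, one_smul, add_sub_cancel] at this
  exact this

end Dbar

/-! ### The Cauchy transform along a complex line -/

section Kernel

variable {V E : Type*} [NormedAddCommGroup V] [NormedSpace ℂ V] [NormedAddCommGroup E]
  [NormedSpace ℂ E]

/-- The measure `dr dθ` on the domain of polar coordinates. -/
noncomputable def polarMeasure : Measure (ℝ × ℝ) :=
  (volume.restrict (Ioi 0)).prod (volume.restrict (Ioc 0 (2 * Real.pi)))

/-- The point of `ℂ` with polar coordinates `a`. -/
noncomputable def polarPoint (a : ℝ × ℝ) : ℂ := a.1 * Complex.exp (a.2 * Complex.I)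

/-- The phase of the Cauchy kernel in polar coordinates. -/
noncomputable def polarPhase (a : ℝ × ℝ) : ℂ := Complex.exp (-(a.2 * Complex.I))

theorem continuous_polarPoint : Continuous polarPoint := by unfold polarPoint; fun_prop

theorem continuous_polarPhase : Continuous polarPhase := by unfold polarPhase; fun_prop

theorem norm_polarPoint (a : ℝ × ℝ) : ‖polarPoint a‖ = |a.1| := by
  simp [polarPoint, Complex.norm_exp]

theorem norm_polarPhase (a : ℝ × ℝ) : ‖polarPhase a‖ = 1 := by
  simp [polarPhase, Complex.norm_exp]

theorem polarMeasure_eq :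
    polarMeasure = volume.restrict (Ioi (0 : ℝ) ×ˢ Ioc 0 (2 * Real.pi)) := by
  rw [polarMeasure, Measure.prod_restrict, Measure.volume_eq_prod]

theorem integrable_polarMeasure {E : Type*} [NormedAddCommGroup E] {g : ℝ × ℝ → E}
    (R : ℝ) (hg : IntegrableOn g (Icc 0 R ×ˢ Icc 0 (2 * Real.pi)))
    (h0 : ∀ a, R < a.1 → g a = 0) : Integrable g polarMeasure := by
  rw [polarMeasure_eq]
  refine IntegrableOn.of_forall_sdiff_eq_zero hg (measurableSet_Ioi.prod measurableSet_Ioc) ?_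
  rintro a ⟨⟨h1, h2⟩, h3⟩
  refine h0 a (not_le.1 fun h => h3 ⟨⟨le_of_lt h1, h⟩, Ioc_subset_Icc_self h2⟩)

theorem integrable_polarMeasure_of_continuous {E : Type*} [NormedAddCommGroup E] {g : ℝ × ℝ → E}
    (hg : Continuous g) (R : ℝ) (h0 : ∀ a, R < a.1 → g a = 0) : Integrable g polarMeasure :=
  integrable_polarMeasure R
    (hg.continuousOn.integrableOn_compact (isCompact_Icc.prod isCompact_Icc)) h0

theorem HasCompactSupport.exists_radius {V E : Type*} [NormedAddCommGroup V] [Zero E] {g : V → E}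
    (hg : HasCompactSupport g) : ∃ R : ℝ, ∀ z, R < ‖z‖ → g z = 0 := by
  obtain ⟨R, hR⟩ := hg.isCompact.isBounded.subset_closedBall 0
  refine ⟨R, fun z hz => image_eq_zero_of_notMem_tsupport fun h => ?_⟩
  have := hR h
  rw [mem_closedBall_zero_iff] at this
  linarith

/-- The area integral of `∂̄ψ / ζ` in polar coordinates. -/
theorem integral_polarPhase_smul_dbarAlong [CompleteSpace E] {ψ : ℂ → E} (hψ : ContDiff ℝ 1 ψ)
    (hc : HasCompactSupport ψ) :
    ∫ a, polarPhase a • dbarAlong 1 ψ (polarPoint a) ∂polarMeasure = -(Real.pi : ℂ) • ψ 0 := by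
  let e : ℝ × ℝ → ℂ := fun a => Complex.exp (a.2 * Complex.I)
  have he : Continuous e := by fun_prop
  let A : ℝ × ℝ → E := fun a => fderiv ℝ ψ (polarPoint a) (e a)
  let B : ℝ × ℝ → E := fun a => fderiv ℝ ψ (polarPoint a) (Complex.I * e a)
  have hfd : Continuous (fderiv ℝ ψ) := hψ.continuous_fderiv (by norm_num)
  have hA : Continuous A := (hfd.comp continuous_polarPoint).clm_apply he
  have hB : Continuous B := (hfd.comp continuous_polarPoint).clm_apply (by fun_prop)
  obtain ⟨R, hR⟩ := (hc.fderiv (𝕜 := ℝ)).exists_radius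
  have hz : ∀ a : ℝ × ℝ, R < a.1 → fderiv ℝ ψ (polarPoint a) = 0 := fun a ha =>
    hR _ (by rw [norm_polarPoint]; exact ha.trans_le (le_abs_self _))
  have hAi : Integrable A polarMeasure :=
    integrable_polarMeasure_of_continuous hA R fun a ha => by simp [A, hz a ha]
  have hBi : Integrable B polarMeasure :=
    integrable_polarMeasure_of_continuous hB R fun a ha => by simp [B, hz a ha]
  -- The polar form of `∂̄`: `A` is the radial derivative of `ψ` and `r • B` the angular one. The
  -- Jacobian `r` has cancelled the singularity of `1 / ζ`, so every integrand is continuous.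
  have hpt : ∀ a, polarPhase a • dbarAlong 1 ψ (polarPoint a) =
      (1 / 2 : ℂ) • (A a + Complex.I • B a) := by
    intro a
    have h1 : e a = Real.cos a.2 • (1 : ℂ) + Real.sin a.2 • Complex.I := by
      simp [e, Complex.exp_mul_I]
    have h2 : Complex.I * e a = Real.cos a.2 • Complex.I - Real.sin a.2 • (1 : ℂ) := by
      rw [h1, mul_add, Complex.real_smul, Complex.real_smul, Complex.real_smul, Complex.real_smul]
      linear_combination (Real.sin a.2 : ℂ) * Complex.I_mul_I
    have h3 : polarPhase a = Real.cos a.2 - Real.sin a.2 * Complex.I := by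
      rw [polarPhase, ← neg_mul, Complex.exp_mul_I]
      simp [sub_eq_add_neg]
    have h4 : A a = Real.cos a.2 • fderiv ℝ ψ (polarPoint a) 1 +
        Real.sin a.2 • fderiv ℝ ψ (polarPoint a) Complex.I := by
      simp only [A, h1, map_add, map_smul]
    have h5 : B a = Real.cos a.2 • fderiv ℝ ψ (polarPoint a) Complex.I -
        Real.sin a.2 • fderiv ℝ ψ (polarPoint a) 1 := by
      simp only [B, h2, map_sub, map_smul]
    rw [h4, h5, dbarAlong, h3, smul_eq_mul, mul_one]
    simp only [← Complex.coe_smul]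
    match_scalars
    · ring
    · linear_combination (-(1 / 2) * Complex.sin a.2) * Complex.I_mul_I
  simp only [hpt]
  rw [integral_smul, integral_add hAi (hBi.fun_smul _), integral_smul]
  have iA : ∫ a, A a ∂polarMeasure = -(2 * Real.pi : ℝ) • ψ 0 := by
    rw [polarMeasure, integral_prod_symm _ hAi]
    have : ∀ θ : ℝ, ∫ r in Ioi (0 : ℝ), A (r, θ) = - ψ 0 := by
      intro θ
      let f : ℝ → E := fun r => ψ (polarPoint (r, θ))
      have hp : ContDiff ℝ 1 fun r : ℝ => polarPoint (r, θ) := by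
        change ContDiff ℝ 1 fun r : ℝ => (r : ℂ) * Complex.exp (θ * Complex.I)
        exact Complex.ofRealCLM.contDiff.mul contDiff_const
      have hf : ContDiff ℝ 1 f := hψ.comp hp
      obtain ⟨R, hR⟩ := hc.exists_radius
      have hfc : HasCompactSupport f :=
        HasCompactSupport.intro (isCompact_closedBall (0 : ℝ) R) fun r hr => hR _ (by
          rw [norm_polarPoint]; simpa using hr)
      have := hfc.integral_Ioi_deriv_eq hf 0
      rw [show f 0 = ψ 0 by simp [f, polarPoint]] at this
      rw [← this]
      congr 1
      ext r
      have hd : HasDerivAt (fun r : ℝ => polarPoint (r, θ)) (e (r, θ)) r := by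
        have := (Complex.ofRealCLM.hasDerivAt (x := r)).mul_const (e (r, θ))
        simpa [polarPoint, e] using this
      exact (((hψ.differentiable (by norm_num) _).hasFDerivAt).comp_hasDerivAt r hd).deriv.symm
    simp [this, Real.pi_pos.le]
  -- On each circle `r • B` is the derivative of a periodic function of the angle.
  have iB : ∫ a, B a ∂polarMeasure = 0 := by
    rw [polarMeasure, integral_prod _ hBi]
    refine setIntegral_eq_zero_of_forall_eq_zero fun r hr => ?_
    rw [← intervalIntegral.integral_of_le (by positivity)]
    have hd : ∀ θ : ℝ, HasDerivAt (fun θ : ℝ => ψ (polarPoint (r, θ))) (r • B (r, θ)) θ := by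
      intro θ
      have h1 : HasDerivAt (fun θ : ℝ => polarPoint (r, θ)) (r • (Complex.I * e (r, θ))) θ := by
        have h := (((Complex.ofRealCLM.hasDerivAt (x := θ)).mul_const Complex.I).cexp).const_mul
          (r : ℂ)
        refine h.congr_deriv ?_
        simp [e, mul_comm]
      have := ((hψ.differentiable (by norm_num) _).hasFDerivAt).comp_hasDerivAt θ h1
      rw [map_smul] at this
      exact this
    have hi := intervalIntegral.integral_eq_sub_of_hasDerivAt (a := 0) (b := 2 * Real.pi)
      (fun θ _ => hd θ)
      ((show Continuous fun θ : ℝ => r • B (r, θ) by fun_prop).intervalIntegrable _ _)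
    have hper : polarPoint (r, 2 * Real.pi) = polarPoint (r, 0) := by
      simp [polarPoint]
    rw [hper, sub_self, intervalIntegral.integral_smul] at hi
    exact (smul_eq_zero.1 hi).resolve_left (ne_of_gt hr)
  rw [iA, iB]
  simp only [← Complex.coe_smul, smul_zero, add_zero, smul_smul]
  congr 1
  push_cast
  ring

/-- Convolution of `g` with the Cauchy kernel of the complex line through `e`, up to a constant. -/
noncomputable def lineCauchy (e : V) (g : V → E) (z : V) : E :=
  ∫ a, polarPhase a • g (z + polarPoint a • e) ∂polarMeasure

theorem lineCauchy_eq_zero {e : V} {g : V → E} {z : V} (h : ∀ ζ : ℂ, g (z + ζ • e) = 0) :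
    lineCauchy e g z = 0 := by
  simp [lineCauchy, h]

/-- A domination uniform for `z` near `z₀`, which permits passing limits and derivatives under the
integral. As `‖e‖ = 1`, the integrand vanishes once the polar radius exceeds the support radius of
`g` plus `‖z₀‖ + 1`. -/
theorem exists_lineCauchy_bound {e : V} (he : ‖e‖ = 1) {g : V → E}
    (hg : Continuous g) (hc : HasCompactSupport g) (z₀ : V) :
    ∃ b : ℝ × ℝ → ℝ, Integrable b polarMeasure ∧ ∀ᵐ a ∂polarMeasure, ∀ z ∈ ball z₀ 1,
      ‖polarPhase a • g (z + polarPoint a • e)‖ ≤ b a := by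
  obtain ⟨C, hC⟩ := hg.bounded_above_of_compact_support hc
  obtain ⟨R, hR⟩ := hc.exists_radius
  refine ⟨(Icc (-(R + ‖z₀‖ + 1)) (R + ‖z₀‖ + 1) ×ˢ univ).indicator fun _ => C, ?_, ?_⟩
  · refine integrable_polarMeasure (R + ‖z₀‖ + 1) ?_ ?_
    · refine IntegrableOn.indicator ?_ (measurableSet_Icc.prod MeasurableSet.univ)
      exact continuous_const.continuousOn.integrableOn_compact (isCompact_Icc.prod isCompact_Icc)
    · intro a ha
      refine indicator_of_notMem ?_ _
      intro h
      exact absurd h.1.2 (not_le.2 ha)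
  · refine .of_forall fun a z hz => ?_
    rw [norm_smul, norm_polarPhase, one_mul]
    by_cases ha : a ∈ Icc (-(R + ‖z₀‖ + 1)) (R + ‖z₀‖ + 1) ×ˢ (univ : Set ℝ)
    · rw [indicator_of_mem ha]; exact hC _
    · rw [indicator_of_notMem ha, hR, norm_zero]
      have h1 : R + ‖z₀‖ + 1 < |a.1| := by
        rw [← not_le, abs_le]
        exact fun h => ha ⟨h, mem_univ _⟩
      have h2 : ‖z‖ < ‖z₀‖ + 1 := by
        have := norm_sub_norm_le z z₀
        rw [mem_ball_iff_norm] at hz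
        linarith
      have h3 : |a.1| = ‖polarPoint a • e‖ := by rw [norm_smul, he, norm_polarPoint, mul_one]
      have h4 : ‖polarPoint a • e‖ ≤ ‖z + polarPoint a • e‖ + ‖z‖ := by
        simpa using norm_sub_le (z + polarPoint a • e) z
      linarith

theorem continuous_lineCauchy {e : V} (he : ‖e‖ = 1) {g : V → E}
    (hg : Continuous g) (hc : HasCompactSupport g) : Continuous (lineCauchy e g) := by
  have hp := continuous_polarPoint
  have hph := continuous_polarPhase
  refine continuous_iff_continuousAt.2 fun z₀ => ?_
  obtain ⟨b, hb, hle⟩ := exists_lineCauchy_bound he hg hc z₀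
  refine continuousAt_of_dominated (bound := b) ?_ ?_ hb ?_
  · exact .of_forall fun z => Continuous.aestronglyMeasurable (by fun_prop)
  · filter_upwards [ball_mem_nhds z₀ one_pos] with z hz
    filter_upwards [hle] with a ha using ha z hz
  · exact .of_forall fun a => Continuous.continuousAt (by fun_prop)

theorem hasFDerivAt_lineCauchy {e : V} (he : ‖e‖ = 1) {g : V → E}
    (hg : ContDiff ℝ 1 g) (hc : HasCompactSupport g) (z₀ : V) :
    HasFDerivAt (lineCauchy e g) (lineCauchy e (fderiv ℝ g) z₀) z₀ := by
  have hp := continuous_polarPoint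
  have hph := continuous_polarPhase
  have hgc := hg.continuous
  have hfd : Continuous (fderiv ℝ g) := hg.continuous_fderiv (by norm_num)
  obtain ⟨b', hb', hle'⟩ := exists_lineCauchy_bound he hgc hc z₀
  obtain ⟨b, hb, hle⟩ := exists_lineCauchy_bound he hfd (hc.fderiv (𝕜 := ℝ)) z₀
  refine hasFDerivAt_integral_of_dominated_of_fderiv_le (bound := b) (ball_mem_nhds z₀ one_pos)
    ?_ ?_ ?_ hle hb ?_
  · exact .of_forall fun z => Continuous.aestronglyMeasurable (by fun_prop)
  · refine hb'.mono' (Continuous.aestronglyMeasurable (by fun_prop)) ?_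
    filter_upwards [hle'] with a ha using ha z₀ (mem_ball_self one_pos)
  · exact Continuous.aestronglyMeasurable (by fun_prop)
  · refine .of_forall fun a z _ => ?_
    have h1 : HasFDerivAt (fun z => g (z + polarPoint a • e)) (fderiv ℝ g (z + polarPoint a • e))
        z := by
      have := ((hg.differentiable (by norm_num) (z + polarPoint a • e)).hasFDerivAt).comp z
        ((hasFDerivAt_id z).add_const (polarPoint a • e))
      rwa [ContinuousLinearMap.comp_id] at this
    exact h1.const_smul (polarPhase a)

theorem contDiff_lineCauchy {e : V} (he : ‖e‖ = 1) {g : V → E}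
    (hg : ContDiff ℝ 1 g) (hc : HasCompactSupport g) : ContDiff ℝ 1 (lineCauchy e g) := by
  refine contDiff_one_iff_fderiv.2
    ⟨fun z => (hasFDerivAt_lineCauchy he hg hc z).differentiableAt, ?_⟩
  rw [show fderiv ℝ (lineCauchy e g) = lineCauchy e (fderiv ℝ g) from
    funext fun z => (hasFDerivAt_lineCauchy he hg hc z).fderiv]
  exact continuous_lineCauchy he (hg.continuous_fderiv (by norm_num)) (hc.fderiv (𝕜 := ℝ))

theorem dbarAlong_lineCauchy [CompleteSpace E] {e : V} (he : ‖e‖ = 1) {g : V → E}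
    (hg : ContDiff ℝ 1 g) (hc : HasCompactSupport g) (v z : V) :
    dbarAlong v (lineCauchy e g) z = lineCauchy e (dbarAlong v g) z := by
  have hp := continuous_polarPoint
  have hph := continuous_polarPhase
  have hfd : Continuous (fderiv ℝ g) := hg.continuous_fderiv (by norm_num)
  obtain ⟨b, hb, hle⟩ := exists_lineCauchy_bound he hfd (hc.fderiv (𝕜 := ℝ)) z
  have hi : Integrable (fun a => polarPhase a • fderiv ℝ g (z + polarPoint a • e)) polarMeasure := by
    refine hb.mono' (Continuous.aestronglyMeasurable (by fun_prop)) ?_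
    filter_upwards [hle] with a ha using ha z (mem_ball_self one_pos)
  have hi' : ∀ w : V,
      Integrable (fun a => polarPhase a • fderiv ℝ g (z + polarPoint a • e) w) polarMeasure :=
    fun w => (ContinuousLinearMap.apply ℝ E w).integrable_comp hi
  have key : ∀ w : V, fderiv ℝ (lineCauchy e g) z w =
      ∫ a, polarPhase a • fderiv ℝ g (z + polarPoint a • e) w ∂polarMeasure := by
    intro w
    rw [(hasFDerivAt_lineCauchy he hg hc z).fderiv, lineCauchy,
      ContinuousLinearMap.integral_apply hi]
    rfl
  rw [dbarAlong, key, key, ← integral_smul, ← integral_add (hi' v) ((hi' _).fun_smul _),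
    ← integral_smul, lineCauchy]
  congr 1
  ext a
  rw [dbarAlong]
  module

/-- A compactly supported solution of the compatibility conditions `∂̄_w φ_v = ∂̄_v φ_w` is the
`∂̄`-derivative of the Cauchy transform along a line. -/
theorem dbarAlong_lineCauchy_of_compat [CompleteSpace E] {e : V} (he : ‖e‖ = 1) {φ : V → V → E}
    (hφ : ∀ v, ContDiff ℝ 1 (φ v)) (hc : ∀ v, HasCompactSupport (φ v))
    (hcomp : ∀ v w z, dbarAlong w (φ v) z = dbarAlong v (φ w) z) (v z : V) :
    dbarAlong v (lineCauchy e (φ e)) z = -(Real.pi : ℂ) • φ v z := by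
  rw [dbarAlong_lineCauchy he (hφ e) (hc e)]
  have h1 : ContDiff ℝ 1 fun ζ : ℂ => z + ζ • e := by fun_prop
  obtain ⟨R, hR⟩ := (hc v).exists_radius
  have h2 : HasCompactSupport fun ζ : ℂ => φ v (z + ζ • e) := by
    refine HasCompactSupport.intro (isCompact_closedBall (0 : ℂ) (R + ‖z‖)) fun ζ hζ => hR _ ?_
    have h4 : ‖ζ • e‖ ≤ ‖z + ζ • e‖ + ‖z‖ := by simpa using norm_sub_le (z + ζ • e) z
    rw [mem_closedBall_zero_iff, not_le] at hζ
    rw [norm_smul, he, mul_one] at h4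
    linarith
  have := integral_polarPhase_smul_dbarAlong ((hφ v).comp h1) h2
  simp only [Function.comp_def, zero_smul, add_zero] at this
  rw [← this, lineCauchy]
  congr 1
  ext a
  congr 1
  -- Compatibility exchanges `∂̄_v φ_e` for `∂̄_e φ_v`, which is the one-variable `∂̄` of `φ v`
  -- restricted to the line through `z`.
  rw [hcomp]
  have hd : ∀ ζ w : ℂ, fderiv ℝ (fun ζ : ℂ => φ v (z + ζ • e)) ζ w =
      fderiv ℝ (φ v) (z + ζ • e) (w • e) := by
    intro ζ w
    have hl : HasFDerivAt (fun ζ : ℂ => z + ζ • e)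
        (((ContinuousLinearMap.id ℂ ℂ).smulRight e).restrictScalars ℝ) ζ :=
      (((hasFDerivAt_id ζ).smul_const e).const_add z).restrictScalars ℝ
    have := (((hφ v).differentiable (by norm_num) (z + ζ • e)).hasFDerivAt).comp ζ hl
    rw [show fderiv ℝ (fun ζ : ℂ => φ v (z + ζ • e)) ζ = _ from HasFDerivAt.fderiv this]
    simp
  simp only [dbarAlong, hd, smul_eq_mul, mul_one, one_smul]

end Kernel

/-! ### Hartogs extension by solving the `∂̄`-equation -/

section Hartogs

theorem eventually_dbarAlong_eq_zero {V E : Type*} [NormedAddCommGroup V] [NormedSpace ℂ V]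
    [NormedAddCommGroup E] [NormedSpace ℂ E] {χ : V → E} {z : V} {c : E}
    (h : χ =ᶠ[𝓝 z] fun _ => c) (v : V) : ∀ᶠ y in 𝓝 z, dbarAlong v χ y = 0 :=
  h.eventually_nhds.mono fun y hy => by
    rw [dbarAlong_congr hy]
    exact dbarAlong_eq_zero_of_differentiableAt (differentiableAt_const c) v

/-- The closed half-line from `z` pointing away from the origin. -/
def outwardRay {V : Type*} [SMul ℝ V] (z : V) : Set V := (fun s : ℝ => s • z) '' Ici 1

section Ray

variable {V : Type*} [NormedAddCommGroup V] [NormedSpace ℝ V]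

theorem mem_outwardRay (z : V) : z ∈ outwardRay z := ⟨1, mem_Ici.2 le_rfl, one_smul _ _⟩

theorem isPreconnected_outwardRay (z : V) : IsPreconnected (outwardRay z) :=
  isPreconnected_Ici.image _ (by fun_prop)

theorem isClosed_outwardRay {z : V} (hz : z ≠ 0) : IsClosed (outwardRay z) :=
  (isClosedEmbedding_smul_left hz).isClosedMap _ isClosed_Ici

theorem norm_le_of_mem_outwardRay {z y : V} (hy : y ∈ outwardRay z) : ‖z‖ ≤ ‖y‖ := by
  obtain ⟨s, hs, rfl⟩ := hy
  have hs : (1 : ℝ) ≤ s := hs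
  simp only [norm_smul, Real.norm_eq_abs, abs_of_nonneg (zero_le_one.trans hs)]
  nlinarith [norm_nonneg z]

theorem eq_of_mem_outwardRay {z y : V} (hy : y ∈ outwardRay z) (h : ‖y‖ ≤ ‖z‖) : y = z := by
  obtain ⟨s, hs, rfl⟩ := hy
  have hs : (1 : ℝ) ≤ s := hs
  simp only [norm_smul, Real.norm_eq_abs, abs_of_nonneg (zero_le_one.trans hs)] at h ⊢
  rcases eq_or_ne z 0 with rfl | hz
  · simp
  · have := norm_pos_iff.2 hz
    have : s = 1 := le_antisymm (by nlinarith) hs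
    simp [this]

theorem not_isBounded_outwardRay {z : V} (hz : z ≠ 0) : ¬ Bornology.IsBounded (outwardRay z) := by
  intro h
  obtain ⟨R, hR⟩ := h.subset_closedBall 0
  have hz' := norm_pos_iff.2 hz
  have h1 : (1 : ℝ) ≤ max 1 ((R + 1) / ‖z‖) := le_max_left _ _
  have := hR ⟨max 1 ((R + 1) / ‖z‖), h1, rfl⟩
  simp only [mem_closedBall_zero_iff, norm_smul, Real.norm_eq_abs,
    abs_of_nonneg (zero_le_one.trans h1)] at this
  have h2 : (R + 1) / ‖z‖ * ‖z‖ ≤ max 1 ((R + 1) / ‖z‖) * ‖z‖ := by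
    gcongr
    exact le_max_right _ _
  rw [div_mul_cancel₀ _ hz'.ne'] at h2
  linarith

/-- An open set is not contained in the smallest ball around a nonempty compact subset. -/
theorem exists_mem_norm_gt [Nontrivial V] {D L : Set V} (hD : IsOpen D) (hL : IsCompact L)
    (hLD : L ⊆ D) (hne : L.Nonempty) : ∃ z ∈ D, ∀ y ∈ L, ‖y‖ < ‖z‖ := by
  obtain ⟨p, hp, hmax⟩ := hL.exists_isMaxOn hne continuous_norm.continuousOn
  by_contra! hcon
  have hsub : D ⊆ closedBall 0 ‖p‖ := fun z hz => by
    obtain ⟨y, hy, hzy⟩ := hcon z hz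
    exact mem_closedBall_zero_iff.2 (hzy.trans (hmax hy))
  have := interior_maximal hsub hD (hLD hp)
  rw [interior_closedBall'] at this
  simp at this

end Ray

variable {n : ℕ} {E : Type*} [NormedAddCommGroup E] [NormedSpace ℂ E] [CompleteSpace E]

/-- The Cauchy transform along a coordinate line vanishes outside a large ball. -/
theorem lineCauchy_single_eventuallyEq_zero {i j : Fin n} (hij : j ≠ i) {L : Set (Fin n → ℂ)}
    {M : ℝ} (hLM : ∀ z ∈ L, ‖z‖ ≤ M) (hL : IsClosed L) {g : (Fin n → ℂ) → E}
    (hg : ∀ z ∉ L, g z = 0)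
    (hu : ∀ z ∉ L, DifferentiableAt ℂ (lineCauchy (Pi.single i 1) g) z) {x : Fin n → ℂ}
    (hx : M < ‖x‖) : lineCauchy (Pi.single i 1) g =ᶠ[𝓝 x] 0 := by
  have hgM : ∀ z, M < ‖z‖ → g z = 0 := fun z hz => hg z fun h => (hLM z h).not_gt hz
  have key : ∀ x : Fin n → ℂ, M < ‖x j‖ → lineCauchy (Pi.single i 1) g =ᶠ[𝓝 x] 0 := by
    intro x hx
    have ho : IsOpen {z : Fin n → ℂ | M < ‖z j‖} :=
      isOpen_lt continuous_const (by fun_prop)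
    filter_upwards [ho.mem_nhds hx] with z hz
    -- The integration line runs in direction `i` and keeps the `j`-th coordinate, so it misses the
    -- support of `g` altogether.
    refine lineCauchy_eq_zero fun ζ => hgM _ ?_
    have h : (z + ζ • (Pi.single i 1 : Fin n → ℂ)) j = z j := by simp [hij]
    have := norm_le_pi_norm (z + ζ • (Pi.single i 1 : Fin n → ℂ)) j
    rw [h] at this
    exact lt_of_lt_of_le hz this
  by_cases hxj : M < ‖x j‖
  · exact key x hxj
  have hex : ∃ k, M < ‖x k‖ := by
    by_contra! hcon
    have hM : 0 ≤ M := (norm_nonneg _).trans (hcon j)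
    exact absurd ((pi_norm_le_iff_of_nonneg hM).2 hcon) (not_le.2 hx)
  obtain ⟨k, hk⟩ := hex
  have hkj : k ≠ j := fun h => hxj (h ▸ hk)
  -- Moving only the `j`-th coordinate keeps the large coordinate `x k`, so this line stays outside
  -- `L`. At the parameter used below its `j`-th coordinate is `|M| + 1`, where vanishing is known.
  let l : ℂ → Fin n → ℂ := fun t => x + t • Pi.single j 1
  have hl : Continuous l := by fun_prop
  have hlk : ∀ t, l t ∉ L := fun t ht => by
    have h : l t k = x k := by simp [l, hkj]
    have := norm_le_pi_norm (l t) k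
    rw [h] at this
    linarith [hLM _ ht]
  refine eventuallyEq_zero_of_isPreconnected hL.isOpen_compl hu
    (isPreconnected_range hl) (range_subset_iff.2 hlk) (x := l ((|M| + 1 : ℝ) - x j))
    (mem_range_self _) (key _ ?_) ⟨0, by simp [l]⟩
  have : l ((|M| + 1 : ℝ) - x j) j = ((|M| + 1 : ℝ) : ℂ) := by simp [l]
  rw [this, Complex.norm_real, Real.norm_eq_abs, abs_of_nonneg (by positivity)]
  linarith [le_abs_self M]

theorem exists_cutoff {K L : Set (Fin n → ℂ)} (hK : IsClosed K) (hKL : K ⊆ interior L) :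
    ∃ χ : (Fin n → ℂ) → ℂ, ContDiff ℝ 2 χ ∧ (∀ z ∈ K, χ =ᶠ[𝓝 z] fun _ => 1) ∧
      ∀ z ∉ L, χ z = 0 := by
  obtain ⟨f, h1, h0, -⟩ := exists_contMDiffMap_one_nhds_of_subset_interior
    (modelWithCornersSelf ℝ (Fin n → ℂ)) (n := 2) hK hKL
  refine ⟨fun z => (f z : ℂ), ?_, fun z hz => ?_, fun z hz => by simp [h0 z hz]⟩
  · exact Complex.ofRealCLM.contDiff.comp f.contMDiff.contDiff
  · filter_upwards [h1.filter_mono (nhds_le_nhdsSet hz)] with y hy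
    simp [hy]

/-- A holomorphic function on `D \ K` agrees with a holomorphic function on `D` on the part of `D`
that is connected to infinity outside a compact neighbourhood `L` of `K`. -/
theorem exists_holAt_eq_of_connected_to_infinity (hn : 2 ≤ n) {D K L : Set (Fin n → ℂ)}
    (hL : IsCompact L) (hLD : L ⊆ D) (hK : IsClosed K) (hKL : K ⊆ interior L)
    {F : (Fin n → ℂ) → E} (hF : ∀ z ∈ D \ K, HolAt F z) :
    ∃ G : (Fin n → ℂ) → E, (∀ z ∈ D, HolAt G z) ∧
      ∀ S ⊆ Lᶜ, IsPreconnected S → ¬ Bornology.IsBounded S → ∀ z ∈ S, G =ᶠ[𝓝 z] F := by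
  obtain ⟨χ, hχ, hχ1, hχ0⟩ := exists_cutoff hK hKL
  have hχ0' : ∀ z ∉ L, χ =ᶠ[𝓝 z] fun _ => 0 := fun z hz => by
    filter_upwards [hL.isClosed.isOpen_compl.mem_nhds hz] with y hy using hχ0 y hy
  -- This is `∂̄(χ F)` on `D \ K`. It is `C¹` everywhere, whatever `F` is off `D \ K`, because `χ`
  -- is locally constant near each point of the complement.
  let φ : (Fin n → ℂ) → (Fin n → ℂ) → E := fun v z => dbarAlong v χ z • F z
  have hφ0 : ∀ v, ∀ z ∉ D \ K, φ v =ᶠ[𝓝 z] fun _ => 0 := by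
    intro v z hz
    have : ∃ c, χ =ᶠ[𝓝 z] fun _ => c := by
      by_cases hzK : z ∈ K
      · exact ⟨1, hχ1 z hzK⟩
      · exact ⟨0, hχ0' z fun h => hz ⟨hLD h, hzK⟩⟩
    obtain ⟨c, hc⟩ := this
    filter_upwards [eventually_dbarAlong_eq_zero hc v] with y hy
    simp [φ, hy]
  have hφL : ∀ v, ∀ z ∉ L, φ v z = 0 := fun v z hz => by
    simp [φ, (eventually_dbarAlong_eq_zero (hχ0' z hz) v).self_of_nhds]
  have hφ : ∀ v, ContDiff ℝ 1 (φ v) := by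
    refine fun v => contDiff_iff_contDiffAt.2 fun z => ?_
    by_cases hz : z ∈ D \ K
    · exact (hχ.dbarAlong v).contDiffAt.smul (hF z hz).1
    · exact contDiffAt_const.congr_of_eventuallyEq (hφ0 v z hz)
  have hφc : ∀ v, HasCompactSupport (φ v) := fun v => HasCompactSupport.intro hL (hφL v)
  have hcomp : ∀ v w z, dbarAlong w (φ v) z = dbarAlong v (φ w) z := by
    have h0 : ∀ v w, ∀ z ∉ D \ K, dbarAlong w (φ v) z = 0 := fun v w z hz =>
      (eventually_dbarAlong_eq_zero (hφ0 v z hz) w).self_of_nhds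
    intro v w z
    by_cases hz : z ∈ D \ K
    · have h1 : ∀ v w, dbarAlong w (φ v) z = dbarAlong w (dbarAlong v χ) z • F z := fun v w => by
        rw [dbarAlong_smul ((hχ.dbarAlong v).differentiable (by norm_num) z)
          ((hF z hz).1.differentiableAt (by norm_num)),
          dbarAlong_eq_zero_of_differentiableAt (hF z hz).2, smul_zero, zero_add]
      rw [h1, h1, dbarAlong_comm hχ]
    · rw [h0 v w z hz, h0 w v z hz]
  let i : Fin n := ⟨0, by omega⟩
  let j : Fin n := ⟨1, by omega⟩
  have hij : j ≠ i := by simp [i, j]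
  let e : Fin n → ℂ := Pi.single i 1
  have he : ‖e‖ = 1 := by rw [Pi.norm_single, norm_one]
  let u₀ : (Fin n → ℂ) → E := lineCauchy e (φ e)
  have hu₀ : ContDiff ℝ 1 u₀ := contDiff_lineCauchy he (hφ e) (hφc e)
  have hdu₀ : ∀ v z, dbarAlong v u₀ z = -(Real.pi : ℂ) • φ v z := fun v z =>
    dbarAlong_lineCauchy_of_compat he hφ hφc hcomp v z
  have hu₀L : ∀ z ∉ L, DifferentiableAt ℂ u₀ z := fun z hz =>
    (HolAt.of_dbarAlong hu₀.contDiffAt fun v => by rw [hdu₀, hφL v z hz, smul_zero]).2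
  -- This normalizes the factor `-π` in `hdu₀`, so that `∂̄(c • u₀) = φ`.
  let c : ℂ := -(Real.pi : ℂ)⁻¹
  refine ⟨fun z => c • u₀ z + (1 - χ z) • F z, fun z hz => ?_, fun S hSL hS hSb z hz => ?_⟩
  · have hc : ∀ v, dbarAlong v (fun _ : Fin n → ℂ => c) z = 0 := fun v =>
      dbarAlong_eq_zero_of_differentiableAt (differentiableAt_const c) v
    have hdu : ∀ v, dbarAlong v (fun z => c • u₀ z) z = φ v z := fun v => by
      rw [dbarAlong_smul (differentiableAt_const c) (hu₀.differentiable (by norm_num) z),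
        hc v, zero_smul, add_zero, hdu₀, smul_smul]
      have : c * -(Real.pi : ℂ) = 1 := by
        have : (Real.pi : ℂ) ≠ 0 := by exact_mod_cast Real.pi_ne_zero
        simp only [c]
        field_simp
      rw [this, one_smul]
    have hcu : ContDiff ℝ 1 fun z => c • u₀ z := contDiff_const.smul hu₀
    by_cases hzK : z ∈ K
    · have hcong : (fun z => c • u₀ z + (1 - χ z) • F z) =ᶠ[𝓝 z] fun z => c • u₀ z := by
        filter_upwards [hχ1 z hzK] with y hy
        simp [hy]
      refine HolAt.congr (HolAt.of_dbarAlong hcu.contDiffAt fun v => ?_) hcong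
      rw [hdu, (hφ0 v z fun h => h.2 hzK).self_of_nhds]
    · have hFz := hF z ⟨hz, hzK⟩
      have h1χ : ContDiff ℝ 1 fun z => 1 - χ z := contDiff_const.sub (hχ.of_le (by norm_num))
      have h1F : ContDiffAt ℝ 1 (fun z => (1 - χ z) • F z) z := h1χ.contDiffAt.smul hFz.1
      refine HolAt.of_dbarAlong (hcu.contDiffAt.add h1F) fun v => ?_
      rw [dbarAlong_add (hcu.differentiable (by norm_num) z) (h1F.differentiableAt (by norm_num)),
        hdu, dbarAlong_smul (h1χ.differentiable (by norm_num) z)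
        (hFz.1.differentiableAt (by norm_num)), dbarAlong_eq_zero_of_differentiableAt hFz.2,
        smul_zero, zero_add, ← add_smul]
      have : dbarAlong v (fun z => 1 - χ z) z = - dbarAlong v χ z := by
        simp only [dbarAlong, fderiv_const_sub, neg_apply, smul_eq_mul]
        ring
      rw [this, add_neg_cancel, zero_smul]
  -- Here `S` need not lie in `D`: outside `L` the cutoff vanishes and `u₀` is holomorphic, so `G =
  -- F` holds wherever `u₀` vanishes locally, even where `F` is not holomorphic.
  · obtain ⟨M, hM⟩ := hL.isBounded.subset_closedBall 0
    have hex : ∃ x ∈ S, M < ‖x‖ := by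
      by_contra! hcon
      exact hSb (isBounded_closedBall.subset fun x hx => mem_closedBall_zero_iff.2 (hcon x hx))
    obtain ⟨x, hxS, hx⟩ := hex
    have hux : u₀ =ᶠ[𝓝 x] 0 := lineCauchy_single_eventuallyEq_zero hij
      (fun z hz => mem_closedBall_zero_iff.1 (hM hz)) hL.isClosed (hφL e) hu₀L hx
    have huz := eventuallyEq_zero_of_isPreconnected hL.isClosed.isOpen_compl hu₀L hS hSL hxS hux hz
    filter_upwards [huz, hχ0' z (hSL hz)] with y hy hy'
    simp [hy, hy']

/-- The Hartogs extension theorem. -/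
theorem hartogs_extension (hn : 2 ≤ n) {D K : Set (Fin n → ℂ)} (hD : IsOpen D) (hK : IsCompact K)
    (hKD : K ⊆ D) (hDK : IsPreconnected (D \ K)) {F : (Fin n → ℂ) → E}
    (hF : ∀ z ∈ D \ K, HolAt F z) :
    ∃ G : (Fin n → ℂ) → E, (∀ z ∈ D, HolAt G z) ∧ EqOn G F (D \ K) := by
  rcases K.eq_empty_or_nonempty with rfl | hKne
  · exact ⟨F, by simpa using hF, fun _ _ => rfl⟩
  have : Nontrivial (Fin n → ℂ) := by
    have : Nonempty (Fin n) := ⟨⟨0, by omega⟩⟩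
    infer_instance
  obtain ⟨L, hL, hKL, hLD⟩ := exists_compact_between hK hD hKD
  obtain ⟨z, hzD, hz⟩ := exists_mem_norm_gt hD hL hLD (hKne.mono (hKL.trans interior_subset))
  have hz0 : z ≠ 0 := by
    obtain ⟨y, hy⟩ := hKne
    exact norm_pos_iff.1 ((norm_nonneg y).trans_lt (hz y (interior_subset (hKL hy))))
  -- Norms do not decrease along the ray, and `z` is already farther out than every point of `L`.
  have hray : outwardRay z ⊆ Lᶜ := fun y hy hyL =>
    (norm_le_of_mem_outwardRay hy).not_gt (hz y hyL)
  obtain ⟨G, hG, hGF⟩ := exists_holAt_eq_of_connected_to_infinity hn hL hLD hK.isClosed hKL hF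
  refine ⟨G, hG, fun y hy => ?_⟩
  have h0 : (fun x => G x - F x) =ᶠ[𝓝 z] 0 := by
    filter_upwards [hGF _ hray (isPreconnected_outwardRay z) (not_isBounded_outwardRay hz0) z
      (mem_outwardRay z)] with x hx
    simp [hx]
  have hzK : z ∈ D \ K := ⟨hzD, fun h => hray (mem_outwardRay z) (interior_subset (hKL h))⟩
  have := eventuallyEq_zero_of_isPreconnected (hD.sdiff hK.isClosed)
    (fun x hx => ((hG x hx.1).sub (hF x hx)).2) hDK Subset.rfl hzK h0 hy
  exact sub_eq_zero.1 this.self_of_nhds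

end Hartogs

/-! ### Extending the conjugation symmetry from `D \ K` to `D` -/

section Symmetry

variable {n : ℕ}

/-- If a bounded open subset `W` of a domain `D` has compact relative boundary in `D`, and if its
closure attains its maximal norm outside `D`, then `D` lies in the same ball as `W`. -/
theorem subset_closedBall_of_frontier_inter_subset (hn : 2 ≤ n) {D W B : Set (Fin n → ℂ)}
    (hD : IsOpen D) (hDc : IsPreconnected D) (hW : IsOpen W) (hWD : W ⊆ D) {p : Fin n → ℂ}
    (hp0 : p ≠ 0) (hpW : p ∈ closure W) (hpD : p ∉ D) (hmax : W ⊆ closedBall 0 ‖p‖)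
    (hB : IsCompact B) (hBD : B ⊆ D) (hBp : B ⊆ closedBall 0 ‖p‖) (hfr : frontier W ∩ D ⊆ B) :
    D ⊆ closedBall 0 ‖p‖ := by
  classical
  by_contra hcon
  obtain ⟨x, hxD, hx⟩ := not_subset.1 hcon
  rw [mem_closedBall_zero_iff, not_le] at hx
  have hx0 : x ≠ 0 := norm_pos_iff.1 ((norm_nonneg p).trans_lt hx)
  have hpB : outwardRay p ⊆ Bᶜ := fun y hy hyB =>
    hpD (eq_of_mem_outwardRay hy (mem_closedBall_zero_iff.1 (hBp hyB)) ▸ hBD hyB)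
  have hxB : outwardRay x ⊆ Bᶜ := fun y hy hyB =>
    ((norm_le_of_mem_outwardRay hy).trans (mem_closedBall_zero_iff.1 (hBp hyB))).not_gt hx
  -- The neighbourhood `L` of `B` is chosen to avoid both rays, so that the extension agrees with
  -- the indicator near `p` and near `x`.
  obtain ⟨L, hL, hBL, hLU⟩ := exists_compact_between hB
    (hD.inter ((isClosed_outwardRay hp0).isOpen_compl.inter (isClosed_outwardRay hx0).isOpen_compl))
    (subset_inter hBD (subset_inter (subset_compl_comm.1 hpB) (subset_compl_comm.1 hxB)))
  let F : (Fin n → ℂ) → ℂ := W.indicator fun _ => 1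
  have hF : ∀ z ∈ D \ B, HolAt F z := by
    rintro z ⟨hzD, hzB⟩
    by_cases hzW : z ∈ W
    · refine (HolAt.const 1 z).congr ?_
      filter_upwards [hW.mem_nhds hzW] with y hy
      exact indicator_of_mem hy _
    -- Within `D` the indicator of `W` can jump only on the frontier of `W`, which is contained in
    -- `B`.
    · have hzc : z ∉ closure W := fun h => hzB (hfr ⟨⟨h, by rwa [hW.interior_eq]⟩, hzD⟩)
      refine (HolAt.const 0 z).congr ?_
      filter_upwards [isClosed_closure.isOpen_compl.mem_nhds hzc] with y hy
      exact indicator_of_notMem (fun h => hy (subset_closure h)) _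
  obtain ⟨G, hG, hGF⟩ := exists_holAt_eq_of_connected_to_infinity hn hL
    (hLU.trans inter_subset_left) hB.isClosed hBL hF
  have hray : ∀ y : Fin n → ℂ, y ≠ 0 → outwardRay y ⊆ Lᶜ → G =ᶠ[𝓝 y] F := fun y hy hyL =>
    hGF _ hyL (isPreconnected_outwardRay y) (not_isBounded_outwardRay hy) y (mem_outwardRay y)
  have hGx : G =ᶠ[𝓝 x] F := hray x hx0 fun y hy hyL => (hLU hyL).2.2 hy
  have hGp : G =ᶠ[𝓝 p] F := hray p hp0 fun y hy hyL => (hLU hyL).2.1 hy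
  have hFx : F =ᶠ[𝓝 x] 0 := by
    filter_upwards [(isOpen_lt continuous_const continuous_norm).mem_nhds hx] with y hy
    exact indicator_of_notMem
      (fun h => (mem_closedBall_zero_iff.1 (hmax h)).not_gt hy) _
  -- Although `p ∉ D`, the agreement of `G` and `F` near `p` reaches points of `W ⊆ D`, where `G` is
  -- `1`; propagation from `x` forces `0` there.
  obtain ⟨w, hw, hwW⟩ := mem_closure_iff_nhds.1 hpW _ hGp
  have h1 : G w = 1 := (show G w = F w from hw).trans (indicator_of_mem hwW _)
  have h0 := (eventuallyEq_zero_of_isPreconnected hD (fun z hz => (hG z hz).2) hDc Subset.rfl hxD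
    (hGx.trans hFx) (hWD hwW)).self_of_nhds
  rw [h1] at h0
  exact one_ne_zero h0

/-- No connected component of `D ∩ D'` is covered by compact subsets of two domains of equal
circumradius. -/
theorem not_connectedComponentIn_subset_union (hn : 2 ≤ n) {D D' K K' : Set (Fin n → ℂ)}
    (hD : IsOpen D) (hDc : IsPreconnected D) (hD' : IsOpen D') (hDc' : IsPreconnected D')
    (hK : IsCompact K) (hKD : K ⊆ D) (hK' : IsCompact K') (hKD' : K' ⊆ D')
    (hr : ∀ r, D ⊆ closedBall 0 r ↔ D' ⊆ closedBall 0 r) {z : Fin n → ℂ} (hz : z ∈ D ∩ D') :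
    ¬ connectedComponentIn (D ∩ D') z ⊆ K ∪ K' := by
  intro hsub
  have : Nontrivial (Fin n → ℂ) := by
    have : Nonempty (Fin n) := ⟨⟨0, by omega⟩⟩
    infer_instance
  set W := connectedComponentIn (D ∩ D') z with hWdef
  have hWo : IsOpen W := (hD.inter hD').connectedComponentIn
  have hzW : z ∈ W := mem_connectedComponentIn hz
  have hWD : W ⊆ D ∩ D' := connectedComponentIn_subset _ _
  have hclos : closure W ⊆ K ∪ K' :=
    closure_minimal hsub (hK.union hK').isClosed
  have hclc : IsCompact (closure W) := (hK.union hK').of_isClosed_subset isClosed_closure hclos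
  -- A frontier point inside `D ∩ D'` could be adjoined to the component `W`, hence would belong to
  -- the open set `W`.
  have hfr : ∀ y ∈ frontier W, y ∈ D → y ∉ D' := by
    intro y hy h1 h2
    have hyW : y ∈ W := by
      have hc : IsPreconnected (insert y W) :=
        isPreconnected_connectedComponentIn.subset_closure (subset_insert _ _)
          (insert_subset hy.1 subset_closure)
      exact hc.subset_connectedComponentIn (mem_insert_of_mem _ hzW)
        (insert_subset (mem_inter h1 h2) hWD) (mem_insert _ _)
    exact hy.2 (by rwa [hWo.interior_eq])
  obtain ⟨p, hp, hmax⟩ :=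
    hclc.exists_isMaxOn (nonempty_of_mem (subset_closure hzW)) continuous_norm.continuousOn
  have hcb : closure W ⊆ closedBall 0 ‖p‖ := fun y hy => mem_closedBall_zero_iff.2 (hmax hy)
  have hWb : W ⊆ ball 0 ‖p‖ := by
    rw [← interior_closedBall']
    exact interior_maximal (subset_closure.trans hcb) hWo
  have hp0 : p ≠ 0 := by
    rintro rfl
    simpa using hWb hzW
  have hpfr : p ∈ frontier W := by
    refine ⟨hp, fun h => ?_⟩
    simpa using hWb (interior_subset h)
  have hpint : ∀ U : Set (Fin n → ℂ), IsOpen U → p ∈ U → ¬ U ⊆ closedBall 0 ‖p‖ := by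
    intro U hU hpU hUs
    have := interior_maximal hUs hU hpU
    rw [interior_closedBall'] at this
    simp at this
  -- In either case the domain that omits `p` is confined to the ball of radius `‖p‖`. By `hr` so is
  -- the domain containing `p`, which contradicts `hpint`.
  rcases hclos hp with hpK | hpK
  · have hpD' := hfr p hpfr (hKD hpK)
    refine hpint D hD (hKD hpK) ((hr _).2 ?_)
    refine subset_closedBall_of_frontier_inter_subset hn hD' hDc' hWo
      (hWD.trans inter_subset_right) hp0 hp hpD' (subset_closure.trans hcb)
      (hK'.inter_left isClosed_frontier) (inter_subset_right.trans hKD')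
      ((inter_subset_left.trans frontier_subset_closure).trans hcb) ?_
    rintro y ⟨hy, hyD'⟩
    exact ⟨hy, (hclos hy.1).resolve_left fun h => hfr y hy (hKD h) hyD'⟩
  · have hpD := fun h => hfr p hpfr h (hKD' hpK)
    refine hpint D' hD' (hKD' hpK) ((hr _).1 ?_)
    refine subset_closedBall_of_frontier_inter_subset hn hD hDc hWo
      (hWD.trans inter_subset_left) hp0 hp hpD (subset_closure.trans hcb)
      (hK.inter_left isClosed_frontier) (inter_subset_right.trans hKD)
      ((inter_subset_left.trans frontier_subset_closure).trans hcb) ?_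
    rintro y ⟨hy, hyD⟩
    exact ⟨hy, (hclos hy.1).resolve_right fun h => hfr y hy hyD (hKD' h)⟩

theorem norm_star_pi (z : Fin n → ℂ) : ‖star z‖ = ‖z‖ := by
  simp [Pi.norm_def]

/-- Schwarz conjugation preserves holomorphy. -/
theorem HolAt.star_comp_star {m : ℕ} {F : (Fin n → ℂ) → Fin m → ℂ} {z : Fin n → ℂ}
    (h : HolAt F (star z)) : HolAt (fun w => star (F (star w))) z := by
  let s : ∀ k, (Fin k → ℂ) →L[ℝ] (Fin k → ℂ) := fun k =>
    (starL' ℝ (A := Fin k → ℂ)).toContinuousLinearMap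
  have hs : ∀ k v, s k v = star v := fun _ _ => rfl
  have hd : HasFDerivAt (fun w => star (F (star w)))
      ((s m).comp ((fderiv ℝ F (star z)).comp (s n))) z :=
    (s m).hasFDerivAt.comp z
      (((h.1.differentiableAt (by norm_num)).hasFDerivAt).comp z (s n).hasFDerivAt)
  refine ⟨?_, differentiableAt_complex_of_fderiv_I_smul hd.differentiableAt fun v => ?_⟩
  · exact (s m).contDiff.contDiffAt.comp z (h.1.comp z (s n).contDiff.contDiffAt)
  · rw [hd.fderiv]
    have hI := fun v => fderiv_I_smul_of_dbarAlong_eq_zero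
      (dbarAlong_eq_zero_of_differentiableAt h.2 v)
    have h1 : star (Complex.I • v) = -(Complex.I • star v) := by simp [star_smul]
    simp only [ContinuousLinearMap.comp_apply, hs, h1, map_neg, hI]
    simp [star_smul]

/-- The Schwarz symmetry of a holomorphic function extends from `D \ K` to `D`. -/
theorem star_eq_of_star_eq_on_diff (hn : 2 ≤ n) {D K : Set (Fin n → ℂ)} (hD : IsOpen D)
    (hDc : IsPreconnected D) (hK : IsCompact K) (hKD : K ⊆ D) {m : ℕ}
    {G : (Fin n → ℂ) → Fin m → ℂ} (hG : ∀ z ∈ D, HolAt G z)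
    (hs : ∀ z ∈ D \ K, star z ∈ D \ K → G (star z) = star (G z)) {z : Fin n → ℂ} (hz : z ∈ D)
    (hz' : star z ∈ D) : G (star z) = star (G z) := by
  have hst : Continuous (star : (Fin n → ℂ) → Fin n → ℂ) := continuous_star
  let D' : Set (Fin n → ℂ) := star ⁻¹' D
  let K' : Set (Fin n → ℂ) := star ⁻¹' K
  have himg : ∀ S : Set (Fin n → ℂ), star ⁻¹' S = star '' S := fun S =>
    (congrFun (image_eq_preimage_of_inverse star_star star_star) S).symm
  have hD' : IsOpen D' := hD.preimage hst
  have hDc' : IsPreconnected D' := by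
    rw [show D' = _ from himg D]; exact hDc.image _ hst.continuousOn
  have hK' : IsCompact K' := by
    rw [show K' = _ from himg K]; exact hK.image hst
  have hr : ∀ r, D ⊆ closedBall 0 r ↔ D' ⊆ closedBall 0 r := by
    intro r
    constructor
    · intro h y hy
      have := h hy
      rwa [mem_closedBall_zero_iff, norm_star_pi, ← mem_closedBall_zero_iff] at this
    · intro h y hy
      have := h (show star y ∈ D' by simpa [D'] using hy)
      rwa [mem_closedBall_zero_iff, norm_star_pi, ← mem_closedBall_zero_iff] at this
  have hzz : z ∈ D ∩ D' := ⟨hz, hz'⟩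
  -- Near `w`, outside `K ∪ K'`, the known symmetry applies; the identity theorem carries it through
  -- the component to `z`.
  obtain ⟨w, hwW, hw⟩ := not_subset.1 (not_connectedComponentIn_subset_union hn hD hDc hD' hDc'
    hK hKD hK' (preimage_mono hKD) hr hzz)
  have hwD := connectedComponentIn_subset _ _ hwW
  have hhol : ∀ y ∈ D ∩ D', DifferentiableAt ℂ (fun y => G y - star (G (star y))) y :=
    fun y hy => ((hG y hy.1).sub (HolAt.star_comp_star (hG _ hy.2))).2
  have h0 : (fun y => G y - star (G (star y))) =ᶠ[𝓝 w] 0 := by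
    filter_upwards [(hD.inter hD').mem_nhds hwD,
      (hK.union hK').isClosed.isOpen_compl.mem_nhds hw] with y hy hyK
    rw [hs y ⟨hy.1, fun h => hyK (Or.inl h)⟩ ⟨hy.2, fun h => hyK (Or.inr h)⟩]
    simp
  have := (eventuallyEq_zero_of_isPreconnected (hD.inter hD') hhol
    isPreconnected_connectedComponentIn (connectedComponentIn_subset _ _) hwW h0
    (mem_connectedComponentIn hzz)).self_of_nhds
  have h := sub_eq_zero.1 this
  rw [h, star_star]

end Symmetry

/-! ### Octonion arithmetic and the sphere of imaginary units -/

namespace Octonion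

@[simp] theorem fst_zero : (0 : Octonion).fst = 0 := rfl
@[simp] theorem snd_zero : (0 : Octonion).snd = 0 := rfl
@[simp] theorem fst_one : (1 : Octonion).fst = 1 := rfl
@[simp] theorem snd_one : (1 : Octonion).snd = 0 := rfl
@[simp] theorem fst_add (x y : Octonion) : (x + y).fst = x.fst + y.fst := rfl
@[simp] theorem snd_add (x y : Octonion) : (x + y).snd = x.snd + y.snd := rfl
@[simp] theorem fst_neg (x : Octonion) : (-x).fst = -x.fst := rfl
@[simp] theorem snd_neg (x : Octonion) : (-x).snd = -x.snd := rfl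
@[simp] theorem fst_smul (c : ℝ) (x : Octonion) : (c • x).fst = c • x.fst := rfl
@[simp] theorem snd_smul (c : ℝ) (x : Octonion) : (c • x).snd = c • x.snd := rfl
@[simp] theorem fst_mul (x y : Octonion) :
    (x * y).fst = x.fst * y.fst - star y.snd * x.snd := rfl
@[simp] theorem snd_mul (x y : Octonion) :
    (x * y).snd = y.snd * x.fst + x.snd * star y.fst := rfl

theorem ext_fst_snd {x y : Octonion} (h₁ : x.fst = y.fst) (h₂ : x.snd = y.snd) : x = y := by
  change mk x.fst x.snd = mk y.fst y.snd
  rw [h₁, h₂]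

theorem zero_mul' (x : Octonion) : 0 * x = 0 := ext_fst_snd (by simp) (by simp)

theorem mul_zero' (x : Octonion) : x * 0 = 0 := ext_fst_snd (by simp) (by simp)

theorem one_mul' (x : Octonion) : 1 * x = x := ext_fst_snd (by simp) (by simp)

theorem mul_neg' (x y : Octonion) : x * -y = -x * y :=
  ext_fst_snd (by simp) (by simp)

theorem smul_mul_smul' (c : ℝ) (x : Octonion) : (c • x) * (c • x) = (c * c) • (x * x) :=
  ext_fst_snd (by simp [smul_smul, smul_sub]) (by simp [smul_smul])

theorem one_ne_zero' : (1 : Octonion) ≠ 0 := fun h => by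
  have := congrArg fst h
  simp at this

theorem ne_zero_of_mem_imaginaryUnits {J : Octonion} (hJ : J ∈ imaginaryUnits) : J ≠ 0 := by
  rintro rfl
  have h : (0 : Octonion) * 0 = -1 := hJ
  rw [zero_mul', eq_comm, neg_eq_zero] at h
  exact one_ne_zero' h

/-- If the real part were nonzero, comparing the imaginary components of `J * J = -1` would make `J`
real, and a real square is not `-1`. -/
theorem re_fst_eq_zero_of_mem_imaginaryUnits {J : Octonion} (hJ : J ∈ imaginaryUnits) :
    J.fst.re = 0 := by
  have h : J * J = -1 := hJ
  by_contra hre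
  have h2 := congrArg snd h
  rw [snd_mul, ← mul_add, Quaternion.self_add_star', snd_neg, snd_one, neg_zero] at h2
  have hb : J.snd = 0 := by
    refine (mul_eq_zero.1 h2).resolve_right fun h0 => hre ?_
    have := congrArg QuaternionAlgebra.re h0
    simpa using this
  have h1 := congrArg fst h
  rw [fst_mul, hb, mul_zero, sub_zero, fst_neg, fst_one] at h1
  have hr := congrArg QuaternionAlgebra.re h1
  have hi := congrArg QuaternionAlgebra.imI h1
  have hj := congrArg QuaternionAlgebra.imJ h1
  have hk := congrArg QuaternionAlgebra.imK h1
  simp only [Quaternion.re_mul, Quaternion.imI_mul, Quaternion.imJ_mul, Quaternion.imK_mul,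
    Quaternion.re_neg, Quaternion.imI_neg, Quaternion.imJ_neg, Quaternion.imK_neg,
    Quaternion.re_one, Quaternion.imI_one, Quaternion.imJ_one, Quaternion.imK_one] at hr hi hj hk
  have hi' : J.fst.imI = 0 := by
    refine (mul_eq_zero.1 (?_ : J.fst.re * J.fst.imI = 0)).resolve_left hre
    linarith
  have hj' : J.fst.imJ = 0 := by
    refine (mul_eq_zero.1 (?_ : J.fst.re * J.fst.imJ = 0)).resolve_left hre
    linarith
  have hk' : J.fst.imK = 0 := by
    refine (mul_eq_zero.1 (?_ : J.fst.re * J.fst.imK = 0)).resolve_left hre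
    linarith
  rw [hi', hj', hk'] at hr
  nlinarith [mul_self_nonneg J.fst.re]

theorem eq_or_eq_neg_of_smul_eq_smul {J J' : Octonion} (hJ : J ∈ imaginaryUnits)
    (hJ' : J' ∈ imaginaryUnits) {b b' : ℝ} (hb : b ≠ 0) (h : b • J = b' • J') :
    J = J' ∨ J = -J' := by
  have hc : J = (b⁻¹ * b') • J' := by rw [mul_smul, ← h, smul_smul, inv_mul_cancel₀ hb, one_smul]
  have h1 : J * J = -1 := hJ
  have h2 : J' * J' = -1 := hJ'
  rw [hc, smul_mul_smul', h2, smul_neg, neg_inj] at h1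
  have h3 : (b⁻¹ * b' * (b⁻¹ * b') - 1) • (1 : Octonion) = 0 := by
    rw [sub_smul, h1, one_smul, sub_self]
  rcases mul_self_eq_one_iff.1 (sub_eq_zero.1 ((smul_eq_zero.1 h3).resolve_right one_ne_zero'))
    with h4 | h4
  · left; rw [hc, h4, one_smul]
  · right; rw [hc, h4, neg_one_smul]

instance : FiniteDimensional ℝ Octonion :=
  inferInstanceAs (FiniteDimensional ℝ (WithLp 2 (ℍ[ℝ] × ℍ[ℝ])))

end Octonion

/-! ### Complex coordinates on the complexified octonions -/

namespace ComplexOctonion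

instance : FiniteDimensional ℝ ComplexOctonion :=
  inferInstanceAs (FiniteDimensional ℝ (WithLp 2 (Octonion × Octonion)))

/-- The number of complex coordinates of a complexified octonion. -/
noncomputable abbrev coordCard : ℕ := Module.finrank ℝ Octonion

/-- The complex coordinates with respect to a real basis of the octonions. -/
noncomputable def coords : ComplexOctonion ≃L[ℝ] (Fin coordCard → ℂ) :=
  LinearEquiv.toContinuousLinearEquiv
    { toFun := fun w k => ⟨(Module.finBasis ℝ Octonion).equivFun w.re k,
        (Module.finBasis ℝ Octonion).equivFun w.im k⟩
      invFun := fun g => mk ((Module.finBasis ℝ Octonion).equivFun.symm fun k => (g k).re)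
        ((Module.finBasis ℝ Octonion).equivFun.symm fun k => (g k).im)
      map_add' := fun w s => by
        funext k
        have h₁ : (w + s).re = w.re + s.re := rfl
        have h₂ : (w + s).im = w.im + s.im := rfl
        apply Complex.ext <;> simp [h₁, h₂]
      map_smul' := fun c w => by
        funext k
        have h₁ : (c • w).re = c • w.re := rfl
        have h₂ : (c • w).im = c • w.im := rfl
        apply Complex.ext <;> simp [h₁, h₂]
      left_inv := fun w => by
        change mk ((Module.finBasis ℝ Octonion).equivFun.symm
          ((Module.finBasis ℝ Octonion).equivFun w.re))
          ((Module.finBasis ℝ Octonion).equivFun.symm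
          ((Module.finBasis ℝ Octonion).equivFun w.im)) = w
        rw [LinearEquiv.symm_apply_apply, LinearEquiv.symm_apply_apply]
        rfl
      right_inv := fun g => by
        funext k
        change Complex.mk ((Module.finBasis ℝ Octonion).equivFun
          ((Module.finBasis ℝ Octonion).equivFun.symm _) k)
          ((Module.finBasis ℝ Octonion).equivFun
          ((Module.finBasis ℝ Octonion).equivFun.symm _) k) = g k
        rw [LinearEquiv.apply_symm_apply, LinearEquiv.apply_symm_apply] }

theorem coords_apply (w : ComplexOctonion) (k : Fin coordCard) :
    coords w k = ⟨(Module.finBasis ℝ Octonion).equivFun w.re k,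
      (Module.finBasis ℝ Octonion).equivFun w.im k⟩ := rfl

theorem I_mul (w : ComplexOctonion) : I * w = mk (-w.im) w.re := by
  change mk (0 * w.re - 1 * w.im) (0 * w.im + 1 * w.re) = _
  rw [Octonion.zero_mul', Octonion.zero_mul', Octonion.one_mul', Octonion.one_mul', zero_sub,
    zero_add]

/-- With `coords_conj`, this reduces holomorphy and the stem condition to ordinary complex analysis;
no other octonion products enter there. -/
theorem coords_I_mul (w : ComplexOctonion) : coords (I * w) = Complex.I • coords w := by
  funext k
  have h₁ : (mk (-w.im) w.re).re = -w.im := rfl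
  have h₂ : (mk (-w.im) w.re).im = w.re := rfl
  rw [Pi.smul_apply, I_mul, coords_apply, coords_apply, h₁, h₂]
  apply Complex.ext <;> simp

theorem coords_conj (w : ComplexOctonion) : coords w.conj = star (coords w) := by
  funext k
  have h₁ : w.conj.re = w.re := rfl
  have h₂ : w.conj.im = -w.im := rfl
  rw [Pi.star_apply, coords_apply, coords_apply, h₁, h₂]
  apply Complex.ext <;> simp

theorem coords_dbar {n : ℕ} (t : Fin n) (F : (Fin n → ℂ) → ComplexOctonion) (z : Fin n → ℂ) :
    coords (dbar t F z) = dbarAlong (Pi.single t 1) (fun x => coords (F x)) z := by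
  have h : fderiv ℝ (fun x => coords (F x)) z =
      (coords : ComplexOctonion →L[ℝ] (Fin coordCard → ℂ)).comp (fderiv ℝ F z) :=
    coords.comp_fderiv
  have h1 : Complex.I • (Pi.single t 1 : Fin n → ℂ) = Pi.single t Complex.I := by
    rw [← Pi.single_smul, smul_eq_mul, mul_one]
  rw [dbar, dbarAlong, h, h1, map_smul, map_add, coords_I_mul, ← Complex.coe_smul]
  norm_num

end ComplexOctonion

open ComplexOctonion in
-- The coordinate equations make the real derivative commute with `Complex.I` on each coordinate
-- axis, and additivity extends this to every direction.
theorem holAt_coords_of_dbar_eq_zero {n : ℕ} {F : (Fin n → ℂ) → ComplexOctonion} {z : Fin n → ℂ}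
    (hF : ContDiffAt ℝ 1 F z) (h : ∀ t, dbar t F z = 0) : HolAt (fun x => coords (F x)) z := by
  have hc : ContDiffAt ℝ 1 (fun x => coords (F x)) z := coords.contDiff.contDiffAt.comp z hF
  refine ⟨hc, differentiableAt_complex_of_fderiv_I_smul (hc.differentiableAt (by norm_num)) ?_⟩
  set A := fderiv ℝ (fun x => coords (F x)) z
  have hA : ∀ t : Fin n, A (Pi.single t Complex.I) = Complex.I • A (Pi.single t 1) := by
    intro t
    have := fderiv_I_smul_of_dbarAlong_eq_zero
      (show dbarAlong (Pi.single t 1) (fun x => coords (F x)) z = 0 by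
        rw [← coords_dbar, h, map_zero])
    rwa [← Pi.single_smul, smul_eq_mul, mul_one] at this
  have key : ∀ (t : Fin n) (c : ℂ), A (Pi.single t c) = c • A (Pi.single t 1) := by
    intro t c
    have hc : (Pi.single t c : Fin n → ℂ) =
        c.re • (Pi.single t 1 : Fin n → ℂ) + c.im • (Pi.single t Complex.I : Fin n → ℂ) := by
      rw [← Pi.single_smul, ← Pi.single_smul, ← Pi.single_add]
      congr 1
      simp [Complex.re_add_im]
    rw [hc, map_add, map_smul, map_smul, hA]
    conv_rhs => rw [← Complex.re_add_im c, add_smul, mul_smul]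
    simp only [Complex.coe_smul]
  intro v
  have hv : ∀ v : Fin n → ℂ, A v = ∑ t, v t • A (Pi.single t 1) := by
    intro v
    conv_lhs => rw [← Finset.univ_sum_single v, map_sum]
    exact Finset.sum_congr rfl fun t _ => key t (v t)
  rw [hv, hv v, Finset.smul_sum]
  simp [smul_smul]

open ComplexOctonion in
theorem isHolomorphicOn_coords_symm {n : ℕ} {D : Set (Fin n → ℂ)}
    {G : (Fin n → ℂ) → Fin coordCard → ℂ} (hG : ∀ z ∈ D, HolAt G z) :
    IsHolomorphicOn D fun z => coords.symm (G z) := by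
  refine ⟨fun z hz => (coords.symm.contDiff.contDiffAt.comp z (hG z hz).1).contDiffWithinAt,
    fun z hz t => coords.injective ?_⟩
  rw [coords_dbar, map_zero]
  simp only [ContinuousLinearEquiv.apply_symm_apply]
  exact dbarAlong_eq_zero_of_differentiableAt (hG z hz).2 _

/-! ### Induced functions on circular sets and the conclusion -/

/-- The values of the function induced by a stem function do not depend on the representation of
the point. -/
theorem IsStemOn.induced_eq_of_slicePoint_eq {n : ℕ} {D : Set (Fin n → ℂ)}
    {F : (Fin n → ℂ) → ComplexOctonion} (hF : IsStemOn D F) {J J' : Octonion}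
    (hJ : J ∈ Octonion.imaginaryUnits) (hJ' : J' ∈ Octonion.imaginaryUnits) {z z' : Fin n → ℂ}
    (hz : z ∈ D) (hz' : z' ∈ D) (h : slicePoint J z = slicePoint J' z') :
    (F z).re + J * (F z).im = (F z').re + J' * (F z').im := by
  have hre : ∀ t, (z t).re = (z' t).re := by
    intro t
    have := congrArg (fun x : Octonion => x.fst.re) (congrFun h t)
    simpa [slicePoint, Octonion.re_fst_eq_zero_of_mem_imaginaryUnits hJ,
      Octonion.re_fst_eq_zero_of_mem_imaginaryUnits hJ'] using this
  have him : ∀ t, (z t).im • J = (z' t).im • J' := by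
    intro t
    have := congrFun h t
    simp only [slicePoint, hre t] at this
    exact add_left_cancel this
  by_cases h0 : ∀ t, (z t).im = 0
  · have h0' : ∀ t, (z' t).im = 0 := fun t => by
      have := him t
      rw [h0 t, zero_smul, eq_comm, smul_eq_zero] at this
      exact this.resolve_right (Octonion.ne_zero_of_mem_imaginaryUnits hJ')
    have hzz : z = z' := funext fun t => Complex.ext (hre t) (by rw [h0, h0'])
    subst hzz
    -- At a real point `J` is arbitrary; the stem condition at `z = star z` kills the `im`
    -- component, so the value does not depend on `J`.
    have hst : star z = z := funext fun t => Complex.ext (by simp) (by simp [h0])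
    have hc := congrArg ComplexOctonion.im (hF z hz (by rwa [hst]))
    rw [hst] at hc
    have hc' : (F z).im + (F z).im = 0 := eq_neg_iff_add_eq_zero.1 hc
    have : (F z).im = 0 := by
      rw [← two_smul ℝ] at hc'
      exact (smul_eq_zero.1 hc').resolve_left two_ne_zero
    rw [this, Octonion.mul_zero', Octonion.mul_zero']
  · push Not at h0
    obtain ⟨t, ht⟩ := h0
    rcases Octonion.eq_or_eq_neg_of_smul_eq_smul hJ hJ' ht (him t) with rfl | rfl
    · have hzz : z = z' := funext fun t => Complex.ext (hre t)
        (smul_left_injective ℝ (Octonion.ne_zero_of_mem_imaginaryUnits hJ) (him t))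
      rw [hzz]
    -- Opposite units represent the same point through conjugate parameters, and the stem condition
    -- compensates the sign.
    · have hzz : z' = star z := funext fun t => Complex.ext (by simp [hre t]) (by
        have := him t
        rw [smul_neg, ← neg_smul] at this
        have := smul_left_injective ℝ (Octonion.ne_zero_of_mem_imaginaryUnits hJ') this
        simpa using this.symm)
      subst hzz
      rw [hF z hz hz']
      change _ = (F z).re + J' * -(F z).im
      rw [Octonion.mul_neg']

/-- Every stem function induces a function on the circular set. -/
theorem IsStemOn.exists_isInducedOn {n : ℕ} {D : Set (Fin n → ℂ)}
    {F : (Fin n → ℂ) → ComplexOctonion} (hF : IsStemOn D F) :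
    ∃ g : (Fin n → Octonion) → Octonion, IsInducedOn D F g := by
  classical
  let val : (Fin n → Octonion) → Octonion → Prop := fun x y =>
    ∃ J ∈ Octonion.imaginaryUnits, ∃ z ∈ D, x = slicePoint J z ∧ y = (F z).re + J * (F z).im
  refine ⟨fun x => if h : ∃ y, val x y then h.choose else 0, fun J hJ z hz => ?_⟩
  have h : ∃ y, val (slicePoint J z) y := ⟨_, J, hJ, z, hz, rfl, rfl⟩
  obtain ⟨J', hJ', z', hz', hx, hy⟩ := h.choose_spec
  simp only [dif_pos h]
  rw [hy]
  exact (hF.induced_eq_of_slicePoint_eq hJ hJ' hz hz' hx).symm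

open ComplexOctonion in
theorem mainTheorem2 (n : ℕ) (hn : 2 ≤ n) (D : Set (Fin n → ℂ)) (hDo : IsOpen D)
    (hDc : IsConnected D) (K : Set (Fin n → ℂ)) (hK : IsCompact K) (hKD : K ⊆ D)
    (hDK : IsConnected (D \ K)) (f : (Fin n → Octonion) → Octonion)
    (hf : IsSliceRegularOn (D \ K) f) :
    ∃ g : (Fin n → Octonion) → Octonion,
      IsSliceRegularOn D g ∧ Set.EqOn g f (circularSet (D \ K)) := by
  obtain ⟨F, hstem, hhol, hind⟩ := hf
  have hDKo : IsOpen (D \ K) := hDo.sdiff hK.isClosed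
  obtain ⟨G, hG, hGF⟩ := hartogs_extension hn hDo hK hKD hDK.isPreconnected
    fun z hz => holAt_coords_of_dbar_eq_zero (hhol.1.contDiffAt (hDKo.mem_nhds hz)) (hhol.2 z hz)
  have hGs : IsStemOn D fun z => coords.symm (G z) := by
    intro z hz hz'
    refine coords.injective ?_
    rw [coords_conj, ContinuousLinearEquiv.apply_symm_apply,
      ContinuousLinearEquiv.apply_symm_apply]
    -- The pair `z`, `star z` may meet `K`, so the stem condition of `F` is not directly available
    -- here.
    refine star_eq_of_star_eq_on_diff hn hDo hDc.isPreconnected hK hKD hG ?_ hz hz'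
    intro w hw hw'
    rw [hGF hw, hGF hw']
    simp only [hstem w hw hw', coords_conj]
  obtain ⟨g, hg⟩ := hGs.exists_isInducedOn
  refine ⟨g, ⟨_, hGs, isHolomorphicOn_coords_symm hG, hg⟩, ?_⟩
  rintro x ⟨J, hJ, z, hz, rfl⟩
  rw [hg J hJ z hz.1, hind J hJ z hz]
  simp only [hGF hz, ContinuousLinearEquiv.symm_apply_apply]
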